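/- For a profinite group $G$ let $\mathrm{d}(G) \in \mathbb{N}_0 \cup \{\infty\}$ denote the minimal number of topological generators of $G$, and let the lower rank of $G$ be $$\mathrm{lr}(G) = \liminf \{\mathrm{d}(H) \mid H \le_{\mathrm{o}} G\} \in \mathbb{N}_0 \cup \{\infty\},$$ where the limit inferior is taken over the net of open subgroups $H$ of $G$ ordered by reverse inclusion. A profinite group is just infinite if it is infinite and each of its non-trivial closed normal subgroups is open; it is hereditarily just infinite if every open subgroup of it is just infinite. Two profinite groups are commensurable if an open subgroup of one is isomorphic, as a topological group, to an open subgroup of the other. Let $n \ge 1$ and let $G_1, \ldots, G_n$ be pairwise non-commensurable hereditarily just infinite profinite groups of finite lower rank. Then the direct product $G = \prod_{i=1}^n G_i$ has lower rank $$\mathrm{lr}(G) = \max \{\mathrm{lr}(G_i) \mid 1 \le i \le n\}.$$ -/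

import Mathlib

/-- The minimal number of topological generators of `G`: the least cardinality of a subset that
generates a dense subgroup. It is `⊤` if `G` is not topologically finitely generated. -/
noncomputable def topGenRank (G : Type*) [Group G] [TopologicalSpace G] : ℕ∞ :=
  ⨅ (S : Set G) (_ : Dense (Subgroup.closure S : Set G)), S.encard

/-- The lower rank of a topological group: the limit inferior of the minimal numbers of topological
generators over the net of open subgroups ordered by reverse inclusion. -/
noncomputable def lowerRank (G : Type*) [Group G] [TopologicalSpace G] [IsTopologicalGroup G] :
    ℕ∞ :=
  Filter.liminf (fun H : OpenSubgroup G => topGenRank H) Filter.atBot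

/-- A topological group is just infinite if it is infinite and every non-trivial closed normal
subgroup is open. -/
def IsJustInfinite (G : Type*) [Group G] [TopologicalSpace G] : Prop :=
  Infinite G ∧
    ∀ N : Subgroup G, N.Normal → IsClosed (N : Set G) → N ≠ ⊥ → IsOpen (N : Set G)

/-- A topological group is hereditarily just infinite if every open subgroup is just infinite. -/
def IsHereditarilyJustInfinite (G : Type*) [Group G] [TopologicalSpace G] : Prop :=
  ∀ H : OpenSubgroup G, IsJustInfinite H

/-- Two topological groups are commensurable if some open subgroup of the first is isomorphic, as a
topological group, to some open subgroup of the second. -/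
def AreCommensurable (G G' : Type*) [Group G] [TopologicalSpace G] [Group G']
    [TopologicalSpace G'] : Prop :=
  ∃ (H : OpenSubgroup G) (K : OpenSubgroup G'), Nonempty (H ≃ₜ* K)

open Filter Topology

/-! Projections are open and surjections do not raise the number of generators, which gives `≥`. For
`≤`, let `m` be the maximum, take small open `V i ≤ G i` generated by `m` elements each, and combine
these into `m` tuples. The closed subgroup `H` they generate projects onto an open subgroup of every
factor, and it remains to see that `H` is open. This is a Goursat-type argument
(`isOpen_map_iInf_ker`): were the elements of `H` trivial in all coordinates but `i` not to fill an
open subgroup of `G i`, just infiniteness would make them trivial, and two factors would turn out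
commensurable. -/

/-- A homomorphism from a compact group which has an open kernel has finite image. -/
theorem MonoidHom.finite_range_of_isOpen_ker {G A : Type*} [Group G] [Group A] [TopologicalSpace A]
    [IsTopologicalGroup A] [CompactSpace A] {g : A →* G}
    (h : IsOpen (g.ker : Set A)) : Finite g.range := by
  have : Finite (A ⧸ g.ker) := Subgroup.quotient_finite_of_isOpen g.ker h
  exact Finite.of_equiv _ (QuotientGroup.quotientKerEquivRange g).toEquiv

section JustInfinite

variable {G G' : Type*} [Group G] [TopologicalSpace G] [Group G'] [TopologicalSpace G']

theorem IsHereditarilyJustInfinite.infinite_of_isOpen (hG : IsHereditarilyJustInfinite G)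
    {P : Subgroup G} (hP : IsOpen (P : Set G)) : Infinite P :=
  (hG ⟨P, hP⟩).1

/-- A non-trivial closed subgroup which is normalized by an open overgroup is open. -/
theorem IsHereditarilyJustInfinite.isOpen_of_normal (hG : IsHereditarilyJustInfinite G)
    {P N : Subgroup G} (hP : IsOpen (P : Set G)) (hNP : N ≤ P)
    (hconj : ∀ p ∈ P, ∀ n ∈ N, p * n * p⁻¹ ∈ N) (hN : IsClosed (N : Set G)) (hne : N ≠ ⊥) :
    IsOpen (N : Set G) := by
  have hopen : IsOpen ((N.subgroupOf P : Subgroup P) : Set P) := by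
    refine (hG ⟨P, hP⟩).2 (N.subgroupOf P) ⟨fun n hn g => ?_⟩
      (hN.preimage continuous_subtype_val) fun h => hne ?_
    · exact hconj g g.2 n hn
    · rw [Subgroup.subgroupOf_eq_bot] at h
      exact h.eq_bot_of_le hNP
  have := hP.isOpenMap_subtype_val _ hopen
  convert this using 1
  ext x
  constructor
  · exact fun hx => ⟨⟨x, hNP hx⟩, hx, rfl⟩
  · rintro ⟨y, hy, rfl⟩
    exact hy

/-- The image of a closed normal subgroup of a compact group under a continuous homomorphism with
open image in a hereditarily just infinite group is trivial or open. -/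
theorem IsHereditarilyJustInfinite.isOpen_map [T2Space G] (hG : IsHereditarilyJustInfinite G)
    {A : Type*} [Group A] [TopologicalSpace A] [CompactSpace A] {f : A →* G} (hf : Continuous f)
    (hfo : IsOpen (f.range : Set G)) {N : Subgroup A} [hn : N.Normal] (hN : IsClosed (N : Set A))
    (hne : N.map f ≠ ⊥) : IsOpen (N.map f : Set G) := by
  refine hG.isOpen_of_normal hfo (Subgroup.map_le_range f N) ?_
    (hN.isCompact.image hf).isClosed hne
  rintro _ ⟨a, rfl⟩ _ ⟨n, hn', rfl⟩
  exact ⟨a * n * a⁻¹, hn.conj_mem n hn' a, by simp⟩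

/-- Two hereditarily just infinite groups that are images, up to finite index, of the same compact
group under homomorphisms with comparable kernels are commensurable. -/
theorem IsHereditarilyJustInfinite.areCommensurable [T2Space G] [T2Space G']
    (hG : IsHereditarilyJustInfinite G) (hG' : IsHereditarilyJustInfinite G')
    {A : Type*} [Group A] [TopologicalSpace A] [IsTopologicalGroup A] [CompactSpace A]
    {f : A →* G} {g : A →* G'} (hf : Continuous f) (hg : Continuous g)
    (hfo : IsOpen (f.range : Set G)) (hgo : IsOpen (g.range : Set G')) (hker : f.ker ≤ g.ker) :
    AreCommensurable G G' := by
  have hgc : IsClosed (g.ker : Set A) := isClosed_singleton.preimage hg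
  -- Otherwise this image is open, hence so is its preimage `g.ker`, and `g` has finite image.
  have hbot : g.ker.map f = ⊥ := by
    by_contra hne
    have hopen := (hG.isOpen_map hf hfo hgc hne).preimage hf
    have hcomap : (g.ker.map f).comap f = g.ker := by
      rw [Subgroup.comap_map_eq, sup_eq_left.2 hker]
    rw [← Subgroup.coe_comap, hcomap] at hopen
    have := MonoidHom.finite_range_of_isOpen_ker hopen
    exact (hG'.infinite_of_isOpen hgo).not_finite this
  have heq : f.ker = g.ker := le_antisymm hker ((Subgroup.map_eq_bot_iff _).1 hbot)
  let e : f.range ≃* g.range :=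
    (QuotientGroup.quotientKerEquivRange f).symm.trans
      ((QuotientGroup.quotientMulEquivOfEq heq).trans (QuotientGroup.quotientKerEquivRange g))
  have he : ∀ a, e (f.rangeRestrict a) = g.rangeRestrict a := fun a => by
    have : (QuotientGroup.quotientKerEquivRange f).symm (f.rangeRestrict a) = (a : A ⧸ f.ker) := by
      rw [MulEquiv.symm_apply_eq]
      rfl
    simp only [e, MulEquiv.trans_apply, this]
    rfl
  have hfr : Continuous f.rangeRestrict := hf.subtype_mk _
  -- By compactness `f.range` carries the quotient topology, so continuity of `e` can be tested on
  -- `A`.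
  have hquot : IsQuotientMap f.rangeRestrict :=
    hfr.isClosedMap.isQuotientMap hfr f.rangeRestrict_surjective
  have hcont : Continuous e := by
    rw [hquot.continuous_iff]
    have : e ∘ f.rangeRestrict = g.rangeRestrict := funext he
    rw [this]
    exact hg.subtype_mk _
  have : CompactSpace f.range := isCompact_iff_compactSpace.1 (isCompact_range hf)
  exact ⟨⟨f.range, hfo⟩, ⟨g.range, hgo⟩, ⟨{ e with
    continuous_toFun := hcont
    continuous_invFun := (hcont.homeoOfEquivCompactToT2 (f := e.toEquiv)).symm.continuous }⟩⟩

end JustInfinite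

section Subdirect

variable {ι : Type*} {G : ι → Type*} [∀ i, Group (G i)] [∀ i, TopologicalSpace (G i)]

/-- Continuous homomorphisms with open images from a compact group to pairwise non-commensurable
hereditarily just infinite groups are independent up to finite index. -/
theorem isOpen_map_iInf_ker [∀ i, T2Space (G i)]
    (hji : ∀ i, IsHereditarilyJustInfinite (G i))
    (hcomm : Pairwise fun i j => ¬ AreCommensurable (G i) (G j))
    {A : Type*} [Group A] [TopologicalSpace A] [IsTopologicalGroup A] [CompactSpace A]
    (f : ∀ i, A →* G i) (hf : ∀ i, Continuous (f i))
    (hfo : ∀ i, IsOpen ((f i).range : Set (G i))) (s : Finset ι) :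
    ∀ i ∉ s, IsOpen (((⨅ k ∈ s, (f k).ker).map (f i) : Subgroup (G i)) : Set (G i)) := by
  classical
  have hnormal : ∀ t : Finset ι, (⨅ k ∈ t, (f k).ker).Normal := fun t =>
    Subgroup.normal_iInf_normal fun k => Subgroup.normal_iInf_normal fun _ => inferInstance
  have hclosed : ∀ t : Finset ι, IsClosed ((⨅ k ∈ t, (f k).ker : Subgroup A) : Set A) := by
    intro t
    simp only [Subgroup.coe_iInf]
    exact isClosed_biInter fun k _ => isClosed_singleton.preimage (hf k)
  induction s using Finset.strongInduction with
  | H s ih =>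
  intro i hi
  have := hnormal s
  refine (hji i).isOpen_map (hf i) (hfo i) (hclosed s) fun hbot => ?_
  rw [Subgroup.map_eq_bot_iff] at hbot
  have hopen : ∀ k ∈ s,
      IsOpen (((⨅ l ∈ s.erase k, (f l).ker).map (f k) : Subgroup (G k)) : Set (G k)) :=
    fun k hk => ih _ (Finset.erase_ssubset hk) k (Finset.notMem_erase k s)
  -- Otherwise this intersection `M` has open image in both `G k` and `G i`. On `M`, `hbot` puts the
  -- kernel of `f k` inside that of `f i`, so `G k` and `G i` are commensurable.
  have htriv : ∀ k ∈ s, ⨅ l ∈ s.erase k, (f l).ker ≤ (f i).ker := by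
    intro k hk
    rw [← Subgroup.map_eq_bot_iff]
    by_contra hne
    have := hnormal (s.erase k)
    have hio := (hji i).isOpen_map (hf i) (hfo i) (hclosed (s.erase k)) hne
    have hko := hopen k hk
    set M : Subgroup A := ⨅ l ∈ s.erase k, (f l).ker with hM
    have : CompactSpace M := isCompact_iff_compactSpace.1 (hclosed (s.erase k)).isCompact
    rw [← Subgroup.range_subtype M, MonoidHom.map_range] at hio hko
    refine hcomm (ne_of_mem_of_not_mem hk hi) ((hji k).areCommensurable (hji i)
      (f := (f k).comp M.subtype) (g := (f i).comp M.subtype)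
      ((hf k).comp continuous_subtype_val) ((hf i).comp continuous_subtype_val) hko hio ?_)
    rintro ⟨x, hx⟩ hxk
    refine hbot ?_
    simp only [hM, Subgroup.mem_iInf, Finset.mem_erase] at hx ⊢
    intro l hl
    by_cases h : l = k
    · subst h
      exact hxk
    · exact hx l ⟨h, hl⟩
  -- Correct one coordinate at a time: a product of elements of `(f i).ker` supplied by `htriv`
  -- agrees with `a` on all of `s`, so by `hbot` it differs from `a` by an element of `(f i).ker`.
  -- As such `a` fill a neighbourhood of 1, `(f i).ker` is open, contradicting infiniteness.
  have key : ∀ a : A, (∀ k ∈ s, f k a ∈ (⨅ l ∈ s.erase k, (f l).ker).map (f k)) →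
      a ∈ (f i).ker := by
    intro a ha
    have aux : ∀ t ⊆ s, ∃ b ∈ (f i).ker, (∀ k ∈ t, f k b = f k a) ∧ ∀ k ∈ s \ t, f k b = 1 := by
      intro t
      induction t using Finset.induction_on with
      | empty => exact fun _ => ⟨1, one_mem _, by simp, by simp⟩
      | insert k t hkt iht =>
        intro hts
        obtain ⟨b, hb, hbt, hbs⟩ := iht ((Finset.subset_insert k t).trans hts)
        have hks : k ∈ s := hts (Finset.mem_insert_self k t)
        obtain ⟨c, hc, hck⟩ := ha k hks
        have hci := htriv k hks hc
        simp only [SetLike.mem_coe, Subgroup.mem_iInf, Finset.mem_erase, MonoidHom.mem_ker] at hc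
        refine ⟨b * c, mul_mem hb hci, fun l hl => ?_, fun l hl => ?_⟩
        · rcases Finset.mem_insert.1 hl with rfl | hl'
          · rw [map_mul, hbs l (by simp [hks, hkt]), hck, one_mul]
          · rw [map_mul, hbt l hl', hc l ⟨by rintro rfl; exact hkt hl', hts hl⟩, mul_one]
        · simp only [Finset.mem_sdiff, Finset.mem_insert, not_or] at hl
          rw [map_mul, hbs l (by simp [hl]), hc l ⟨hl.2.1, hl.1⟩, mul_one]
    obtain ⟨b, hb, hbs, -⟩ := aux s subset_rfl
    have : a * b⁻¹ ∈ (f i).ker := by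
      refine hbot ?_
      simp only [Subgroup.mem_iInf]
      intro k hk
      simp [MonoidHom.mem_ker, hbs k hk]
    simpa using mul_mem this hb
  have hker : IsOpen ((f i).ker : Set A) := by
    have hU : IsOpen (⋂ k ∈ s, f k ⁻¹' ((⨅ l ∈ s.erase k, (f l).ker).map (f k) :
        Subgroup (G k))) :=
      isOpen_biInter_finset fun k hk => (hopen k hk).preimage (hf k)
    refine Subgroup.isOpen_of_mem_nhds (f i).ker (g := 1) (mem_of_superset (hU.mem_nhds ?_) ?_)
    · simp only [Set.mem_iInter, Set.mem_preimage, map_one, SetLike.mem_coe]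
      exact fun _ _ => one_mem _
    · intro a ha
      simp only [Set.mem_iInter] at ha
      exact key a ha
  exact ((hji i).infinite_of_isOpen (hfo i)).not_finite
    (MonoidHom.finite_range_of_isOpen_ker hker)

/-- The box formed by the coordinate slices of `H` is an open neighbourhood of 1 inside `H`. -/
theorem Subgroup.isOpen_pi_of_isOpen_mulSingle [Finite ι] [DecidableEq ι]
    [∀ i, IsTopologicalGroup (G i)] (H : Subgroup (∀ i, G i))
    (h : ∀ i, IsOpen ((H.comap (MonoidHom.mulSingle G i) : Subgroup (G i)) : Set (G i))) :
    IsOpen (H : Set (∀ i, G i)) := by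
  have hU := isOpen_set_pi Set.finite_univ fun i _ => h i
  refine Subgroup.isOpen_of_mem_nhds H (g := 1) (mem_of_superset (hU.mem_nhds ?_) ?_)
  · exact fun i _ => one_mem (H.comap (MonoidHom.mulSingle G i))
  · exact fun x hx => Subgroup.pi_mem_of_mulSingle_mem x fun i => hx i trivial

/-- A closed subgroup of a direct product of pairwise non-commensurable hereditarily just infinite
compact groups is open if its projections to all factors are open. -/
theorem Subgroup.isOpen_pi_of_isOpen_map_eval [Finite ι]
    [∀ i, IsTopologicalGroup (G i)] [∀ i, CompactSpace (G i)] [∀ i, T2Space (G i)]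
    (hji : ∀ i, IsHereditarilyJustInfinite (G i))
    (hcomm : Pairwise fun i j => ¬ AreCommensurable (G i) (G j))
    (H : Subgroup (∀ i, G i)) (hH : IsClosed (H : Set (∀ i, G i)))
    (hproj : ∀ i, IsOpen ((H.map (Pi.evalMonoidHom G i) : Subgroup (G i)) : Set (G i))) :
    IsOpen (H : Set (∀ i, G i)) := by
  classical
  have := Fintype.ofFinite ι
  refine H.isOpen_pi_of_isOpen_mulSingle fun i => ?_
  have : CompactSpace H := isCompact_iff_compactSpace.1 hH.isCompact
  have hopen := isOpen_map_iInf_ker hji hcomm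
    (fun i => (Pi.evalMonoidHom G i).comp H.subtype)
    (fun i => (continuous_apply i).comp continuous_subtype_val)
    (fun i => by rw [MonoidHom.range_comp, Subgroup.range_subtype]; exact hproj i)
    (Finset.univ.erase i) i (Finset.notMem_erase i _)
  refine Subgroup.isOpen_mono ?_ hopen
  rintro _ ⟨x, hx, rfl⟩
  simp only [SetLike.mem_coe, Subgroup.mem_iInf, Finset.mem_erase, Finset.mem_univ, and_true,
    MonoidHom.mem_ker] at hx
  have : Pi.mulSingle i ((x : ∀ i, G i) i) = (x : ∀ i, G i) := by
    ext j
    by_cases h : j = i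
    · subst h
      simp
    · rw [Pi.mulSingle_eq_of_ne h]
      exact (hx j h).symm
  change Pi.mulSingle i ((x : ∀ i, G i) i) ∈ H
  rw [this]
  exact x.2

end Subdirect

section Generators

variable {G G' : Type*} [Group G] [TopologicalSpace G] [Group G'] [TopologicalSpace G']

theorem topGenRank_le_of_surjective (f : G →* G') (hf : Continuous f)
    (hsurj : Function.Surjective f) : topGenRank G' ≤ topGenRank G := by
  refine le_iInf₂ fun S hS => ?_
  refine (iInf₂_le (f '' S) ?_).trans (Set.encard_image_le f S)
  rw [← MonoidHom.map_closure]
  exact hsurj.denseRange.dense_image hf hS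

theorem topGenRank_topologicalClosure_le [IsTopologicalGroup G] (S : Set G) :
    topGenRank (Subgroup.closure S).topologicalClosure ≤ S.encard := by
  set H := (Subgroup.closure S).topologicalClosure
  have hSH : S ⊆ Set.range (Subtype.val : H → G) := by
    rw [Subtype.range_coe]
    exact Subgroup.subset_closure.trans (Subgroup.le_topologicalClosure _)
  have himage : Subtype.val '' (Subtype.val ⁻¹' S : Set H) = S :=
    Set.image_preimage_eq_of_subset hSH
  refine (iInf₂_le (Subtype.val ⁻¹' S : Set H) ?_).trans_eq ?_
  · rw [Subtype.dense_iff]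
    have : Subtype.val '' ((Subgroup.closure (Subtype.val ⁻¹' S : Set H) : Subgroup H) : Set H) =
        (Subgroup.closure S : Set G) := by
      conv_rhs => rw [← himage]
      exact congrArg SetLike.coe (MonoidHom.map_closure H.subtype _)
    exact (congrArg closure this).ge
  · rw [← Subtype.val_injective.encard_image, himage]

theorem exists_dense_closure_range_of_topGenRank_le {m : ℕ} (h : topGenRank G ≤ m) :
    ∃ x : Fin m → G, Dense (Subgroup.closure (Set.range x) : Set G) := by
  obtain ⟨S, hS, hSm⟩ : ∃ S : Set G, Dense (Subgroup.closure S : Set G) ∧ S.encard ≤ m := by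
    have : topGenRank G < (m + 1 : ℕ) := h.trans_lt (by exact_mod_cast Nat.lt_succ_self m)
    simp only [topGenRank, iInf_lt_iff] at this
    obtain ⟨S, hS, hlt⟩ := this
    exact ⟨S, hS, Order.le_of_lt_add_one (by exact_mod_cast hlt)⟩
  have hfin : S.Finite := Set.finite_of_encard_le_coe hSm
  have := hfin.fintype
  obtain ⟨e⟩ : Nonempty (S ↪ Fin m) := by
    refine Function.Embedding.nonempty_of_card_le ?_
    rw [Fintype.card_fin, ← Set.toFinset_card]
    rw [Set.encard_eq_coe_toFinset_card] at hSm
    exact_mod_cast hSm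
  -- Unused indices are padded with 1, which keeps the closure dense.
  refine ⟨Function.extend e Subtype.val 1, hS.mono (Subgroup.closure_mono fun s hs => ?_)⟩
  exact ⟨e ⟨s, hs⟩, e.injective.extend_apply _ _ _⟩

end Generators

section LowerRank

variable {G : Type*} [Group G] [TopologicalSpace G] [IsTopologicalGroup G]

theorem lowerRank_eq_iSup_iInf :
    lowerRank G = ⨆ U : OpenSubgroup G, ⨅ H : OpenSubgroup G, ⨅ _ : H ≤ U, topGenRank H := by
  rw [lowerRank, (atBot_basis (α := OpenSubgroup G)).liminf_eq_iSup_iInf]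
  simp

/-- For finite `m`, `≤ m` means `< m + 1`, and a strict bound on an infimum yields a witness. -/
theorem lowerRank_le_coe_iff {m : ℕ} :
    lowerRank G ≤ m ↔ ∀ U : OpenSubgroup G, ∃ H : OpenSubgroup G, H ≤ U ∧ topGenRank H ≤ m := by
  have hlt : ∀ a : ℕ∞, a ≤ m ↔ a < (m + 1 : ℕ) := fun a => by
    rw [Nat.cast_succ, ENat.lt_natCast_add_one_iff]
  rw [lowerRank_eq_iSup_iInf, iSup_le_iff]
  refine forall_congr' fun U => ?_
  rw [hlt]
  simp only [iInf_lt_iff, hlt, exists_prop]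

theorem lowerRank_le_of_isOpenMap {G' : Type*} [Group G'] [TopologicalSpace G']
    [IsTopologicalGroup G'] (f : G →* G') (hf : Continuous f) (hfo : IsOpenMap f) :
    lowerRank G' ≤ lowerRank G := by
  rw [lowerRank_eq_iSup_iInf, lowerRank_eq_iSup_iInf]
  refine iSup_le fun U => le_iSup_of_le (U.comap f hf) (le_iInf₂ fun H hH => ?_)
  refine (iInf₂_le (⟨(H : Subgroup G).map f, hfo _ H.isOpen⟩ : OpenSubgroup G') ?_).trans ?_
  · rintro _ ⟨x, hx, rfl⟩
    exact hH hx
  · exact topGenRank_le_of_surjective (f.subgroupMap (H : Subgroup G))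
      ((hf.comp continuous_subtype_val).subtype_mk _) (f.subgroupMap_surjective _)

end LowerRank

theorem lowerRank_pi_le {ι : Type*} [Finite ι] {G : ι → Type*}
    [∀ i, Group (G i)] [∀ i, TopologicalSpace (G i)] [∀ i, IsTopologicalGroup (G i)]
    [∀ i, CompactSpace (G i)] [∀ i, T2Space (G i)]
    (hji : ∀ i, IsHereditarilyJustInfinite (G i))
    (hcomm : Pairwise fun i j => ¬ AreCommensurable (G i) (G j))
    {m : ℕ} (hm : ∀ i, lowerRank (G i) ≤ m) : lowerRank (∀ i, G i) ≤ m := by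
  classical
  rw [lowerRank_le_coe_iff]
  intro U
  -- Each `V i` embeds into `U` along its coordinate, so the product of the `V i` lies in `U`.
  choose V hVU hVm using fun i => lowerRank_le_coe_iff.1 (hm i)
    (U.comap (MonoidHom.mulSingle G i) (continuous_mulSingle i))
  choose x hx using fun i => exists_dense_closure_range_of_topGenRank_le (hVm i)
  let y : Fin m → ∀ i, G i := fun j i => x i j
  have hVclosed : ∀ i, IsClosed (V i : Set (G i)) := fun i => (V i).isClosed
  set H := (Subgroup.closure (Set.range y)).topologicalClosure with hH
  have hclosed : IsClosed (H : Set (∀ i, G i)) := Subgroup.isClosed_topologicalClosure _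
  have hproj : ∀ i, IsOpen ((H.map (Pi.evalMonoidHom G i) : Subgroup (G i)) : Set (G i)) := by
    intro i
    refine Subgroup.isOpen_mono (H₁ := (V i : Subgroup (G i))) ?_ (V i).isOpen
    have hmapclosed : IsClosed ((H.map (Pi.evalMonoidHom G i) : Subgroup (G i)) : Set (G i)) :=
      (hclosed.isCompact.image (continuous_apply i)).isClosed
    have hle : Subgroup.closure (Set.range (x i)) ≤
        (H.map (Pi.evalMonoidHom G i)).comap (V i : Subgroup (G i)).subtype := by
      rw [Subgroup.closure_le]
      rintro _ ⟨j, rfl⟩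
      exact ⟨y j, Subgroup.le_topologicalClosure _ (Subgroup.subset_closure ⟨j, rfl⟩), rfl⟩
    -- The projection of `H` is closed and contains topological generators of `V i`, hence all of `V
    -- i`.
    intro v hv
    have hmem : (⟨v, hv⟩ : V i) ∈ closure (Subgroup.closure (Set.range (x i)) : Set (V i)) := hx i _
    exact closure_minimal hle (hmapclosed.preimage continuous_subtype_val) hmem
  have hopen := H.isOpen_pi_of_isOpen_map_eval hji hcomm hclosed hproj
  refine ⟨⟨H, hopen⟩, ?_, ?_⟩
  · have hHV : H ≤ Subgroup.pi Set.univ fun i => (V i : Subgroup (G i)) := by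
      refine Subgroup.topologicalClosure_minimal _ ?_ (isClosed_set_pi fun i _ => hVclosed i)
      rw [Subgroup.closure_le]
      rintro _ ⟨j, rfl⟩ i -
      exact (x i j).2
    intro h hh
    exact Subgroup.pi_mem_of_mulSingle_mem (H := (U : Subgroup (∀ i, G i))) h fun i =>
      hVU i (hHV hh i trivial)
  · refine (topGenRank_topologicalClosure_le (Set.range y)).trans ?_
    rw [← Set.image_univ]
    refine (Set.encard_image_le _ _).trans ?_
    simp

theorem corollaryB {ι : Type*} [Fintype ι] [Nonempty ι] (G : ι → Type*)
    [∀ i, Group (G i)] [∀ i, TopologicalSpace (G i)] [∀ i, IsTopologicalGroup (G i)]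
    [∀ i, CompactSpace (G i)] [∀ i, T2Space (G i)] [∀ i, TotallyDisconnectedSpace (G i)]
    (hji : ∀ i, IsHereditarilyJustInfinite (G i))
    (hlr : ∀ i, lowerRank (G i) < ⊤)
    (hcomm : Pairwise fun i j => ¬ AreCommensurable (G i) (G j)) :
    lowerRank (∀ i, G i) =
      Finset.univ.sup' Finset.univ_nonempty (fun i => lowerRank (G i)) := by
  apply le_antisymm
  -- Finiteness of the maximum provides the natural number `m` of generators.
  · obtain ⟨m, hm⟩ := ENat.ne_top_iff_exists.1
      ((Finset.sup'_lt_iff Finset.univ_nonempty).2 fun i _ => hlr i).ne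
    rw [← hm]
    refine lowerRank_pi_le hji hcomm fun i => ?_
    rw [hm]
    exact Finset.le_sup' (fun i => lowerRank (G i)) (Finset.mem_univ i)
  · exact Finset.sup'_le _ _ fun i _ =>
      lowerRank_le_of_isOpenMap (Pi.evalMonoidHom G i) (continuous_apply i) (isOpenMap_eval i)
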